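/- Let $X$ be a complex Banach space. For $\varphi:\mathbb Z\to X$ define the sum function $S\varphi:\mathbb Z\to X$ by $S\varphi(t)=\sum_{k=0}^{t-1}\varphi(k)$ and $S\varphi(-t)=-\sum_{k=-t}^{-1}\varphi(k)$ for $t\ge 1$, and $S\varphi(0)=0$; let $S^m\varphi=S(S^{m-1}\varphi)$ with $S^0\varphi=\varphi$. For an integer $N\ge 0$ let $w_N(t)=(1+|t|)^N$, and let $BUC_{w_N}(\mathbb Z,X)$ be the space of all $f:\mathbb Z\to X$ with $\sup_{t\in\mathbb Z}\|f(t)\|/w_N(t)<\infty$. Let $AP(\mathbb Z,X)$ be the space of Bohr almost periodic functions, i.e. those $\varphi$ such that, for every $\varepsilon>0$, finitely many translates of $\{\tau\in\mathbb Z:\ \|\varphi(t+\tau)-\varphi(t)\|\le\varepsilon\ \text{for all } t\in\mathbb Z\}$ cover $\mathbb Z$. A bounded $\varphi:\mathbb Z\to X$ has (Maak) mean $M\varphi\in X$ if for every $\varepsilon>0$ there is a finite non-empty $F\subset\mathbb Z$ with $\big\|\frac1{|F|}\sum_{t\in F}(\varphi(s+t)-M\varphi)\big\|<\varepsilon$ for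 all $s\in\mathbb Z$; such an element $M\varphi$ is unique. **Theorem 7.7.** Let $\varphi\in AP(\mathbb Z,X)$, $N\ge 0$ and $b_0,\dots,b_N\in\mathbb C$ with $b_0\neq0$, and suppose that the function $t\mapsto\sum_{j=0}^N b_j\,t^{N-j}\,S^{j+1}\varphi(t)$ belongs to $BUC_{w_N}(\mathbb Z,X)$ (where $t^0=1$). Then $\varphi$ has a mean $M\varphi$, and: (a) $S(\varphi-M\varphi)$ is bounded; and if $\sum_{j=0}^N \frac{b_j}{(j+1)!}\neq 0$, then $M\varphi=0$, and so $S\varphi$ is bounded. (b) If $X$ has no closed linear subspace isomorphic to $c_0$, then $S(\varphi-M\varphi)\in AP(\mathbb Z,X)$. -/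

import Mathlib

open scoped ZeroAtInfty

namespace SumAP

variable {X : Type*} [NormedAddCommGroup X]

/-- The sum function: `(S φ)(t) = ∑_{k=0}^{t-1} φ k` for `t ≥ 1`, `(S φ)(0) = 0`, and
`(S φ)(-t) = -∑_{k=-t}^{-1} φ k` for `t ≥ 1` (at most one of the two index sets below
is non-empty). -/
noncomputable def sumFn (φ : ℤ → X) : ℤ → X := fun t =>
  ∑ k ∈ Finset.Ico 0 t, φ k - ∑ k ∈ Finset.Ico t 0, φ k

/-- The iterated sum `S^m φ`, with `S^0 φ = φ` and `S^m φ = S (S^(m-1) φ)`. -/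
noncomputable def iterSum (m : ℕ) (φ : ℤ → X) : ℤ → X := sumFn^[m] φ

/-- The weight `w_N(t) = (1 + |t|)^N` on `ℤ`. -/
def polyWeight (N : ℕ) (t : ℤ) : ℝ := (1 + |(t : ℝ)|) ^ N

/-- Membership in `BUC_w(ℤ, X)`. As `ℤ` is discrete, this is the space of all `w`-bounded
functions, that is, `‖f t‖ / w t` is bounded; uniform continuity is automatic. -/
def MemBUCWeight (w : ℤ → ℝ) (f : ℤ → X) : Prop :=
  ∃ C : ℝ, ∀ t : ℤ, ‖f t‖ / w t ≤ C

/-- Membership in `BUC(ℤ, X)`, the case of the weight `w = 1`. -/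
def MemBUC (f : ℤ → X) : Prop := MemBUCWeight (fun _ => 1) f

/-- `E ⊆ ℤ` is relatively dense: finitely many translates of `E` cover `ℤ`. -/
def RelativelyDense (E : Set ℤ) : Prop :=
  ∃ F : Finset ℤ, ∀ t : ℤ, ∃ a ∈ F, ∃ e ∈ E, t = e + a

/-- Bohr almost periodicity on `ℤ`: for every `ε > 0` the set of `ε`-periods is
relatively dense. -/
def MemAP (φ : ℤ → X) : Prop :=
  ∀ ε : ℝ, 0 < ε → RelativelyDense {τ : ℤ | ∀ t : ℤ, ‖φ (t + τ) - φ t‖ ≤ ε}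

variable [NormedSpace ℂ X]

/-- `φ` is ergodic in the sense of Maak, with mean `a`: it is bounded and finite averages
of translates of `φ` come uniformly close to the constant `a`. -/
def HasMaakMean (φ : ℤ → X) (a : X) : Prop :=
  MemBUC φ ∧ ∀ ε : ℝ, 0 < ε → ∃ F : Finset ℤ, F.Nonempty ∧
    ∀ s : ℤ, ‖((F.card : ℂ)⁻¹) • ∑ t ∈ F, (φ (s + t) - a)‖ < ε

/-- The Maak mean is unique. -/
theorem HasMaakMean.unique {φ : ℤ → X} {a b : X} (ha : HasMaakMean φ a)
    (hb : HasMaakMean φ b) : a = b := by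
  by_contra hne
  have hpos : 0 < ‖a - b‖ := norm_pos_iff.mpr (sub_ne_zero.mpr hne)
  obtain ⟨F, hF, h1⟩ := ha.2 (‖a - b‖ / 2) (by positivity)
  obtain ⟨G, hG, h2⟩ := hb.2 (‖a - b‖ / 2) (by positivity)
  have hFc : (0 : ℝ) < F.card := by exact_mod_cast hF.card_pos
  have hGc : (0 : ℝ) < G.card := by exact_mod_cast hG.card_pos
  have key : ∀ (H : Finset ℤ) (c : X), (0 : ℝ) < H.card →
      (∀ s : ℤ, ‖((H.card : ℂ)⁻¹) • ∑ t ∈ H, (φ (s + t) - c)‖ < ‖a - b‖ / 2) →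
      ∀ s : ℤ, ‖∑ t ∈ H, (φ (s + t) - c)‖ < H.card * (‖a - b‖ / 2) := by
    intro H c hH h s
    have := h s
    rw [norm_smul, norm_inv, Complex.norm_natCast, inv_mul_lt_iff₀ hH] at this
    exact this
  have k1 := key F a hFc h1
  have k2 := key G b hGc h2
  have s1 : ‖∑ s ∈ G, ∑ t ∈ F, (φ (s + t) - a)‖ < G.card * (F.card * (‖a - b‖ / 2)) := by
    refine (norm_sum_le _ _).trans_lt ?_
    refine (Finset.sum_lt_sum_of_nonempty hG (fun s _ => k1 s)).trans_eq ?_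
    rw [Finset.sum_const, nsmul_eq_mul]
  have s2 : ‖∑ t ∈ F, ∑ s ∈ G, (φ (t + s) - b)‖ < F.card * (G.card * (‖a - b‖ / 2)) := by
    refine (norm_sum_le _ _).trans_lt ?_
    refine (Finset.sum_lt_sum_of_nonempty hF (fun s _ => k2 s)).trans_eq ?_
    rw [Finset.sum_const, nsmul_eq_mul]
  have e : (∑ t ∈ F, ∑ s ∈ G, (φ (t + s) - b)) - ∑ s ∈ G, ∑ t ∈ F, (φ (s + t) - a)
      = ((G.card : ℂ) * F.card) • (a - b) := by
    rw [Finset.sum_comm, ← Finset.sum_sub_distrib]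
    simp only [← Finset.sum_sub_distrib]
    have : ∀ s t : ℤ, φ (t + s) - b - (φ (s + t) - a) = a - b := by
      intro s t
      rw [add_comm t s]; abel
    simp only [this, Finset.sum_const, ← Nat.cast_smul_eq_nsmul ℂ, smul_smul]
  have n1 := norm_sub_le (∑ t ∈ F, ∑ s ∈ G, (φ (t + s) - b))
    (∑ s ∈ G, ∑ t ∈ F, (φ (s + t) - a))
  rw [e, norm_smul, norm_mul, Complex.norm_natCast, Complex.norm_natCast] at n1
  nlinarith

open Classical in
/-- The Maak mean `M φ` (with value `0` if `φ` is not ergodic). -/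
noncomputable def maakMean (φ : ℤ → X) : X :=
  if h : ∃ a, HasMaakMean φ a then h.choose else 0

/-- `c₀ ⊆ X`: the space `X` has a subspace isomorphic to `c₀`, that is, there is a bounded
linear map from `c₀` to `X` that is bounded below. -/
def ContainsC0 (X : Type*) [NormedAddCommGroup X] [NormedSpace ℂ X] : Prop :=
  ∃ T : C₀(ℕ, ℂ) →L[ℂ] X, ∃ c : ℝ, 0 < c ∧ ∀ f : C₀(ℕ, ℂ), c * ‖f‖ ≤ ‖T f‖

end SumAP

/-! Averages of an almost periodic `φ` over long windows converge uniformly to a mean `a`, so `φ₀ =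
φ - a` has `S φ₀ (n) = o(n)` and hence `S^(j+1) φ₀ (n) = o(n^(j+1))`. The constant `a` contributes
`n.choose (j+1) • a` to the iterated sum, hence `n^(N+1) • c • a + O(n^N)` to the whole combination,
where `c = ∑ b j / (j+1)!`. As the combination is `O(n^N)`, comparing orders gives `c • a = 0`, and
the same combination for `φ₀` is again `O(n^N)`.

Divided by `n^N` it reads `b 0 • S φ₀ (n) + H n`, where the increments of `H` tend to `0`. So far
out the increments of `S φ₀` over windows of any fixed length are bounded by one constant
(`exists_eventually_norm_sumFn_add_sub_le`); a distant almost period carries this bound back to the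
origin (`MemAP.memBUC_sumFn`).

For (b), if the bounded `S φ₀` were not almost periodic, there would be ever better almost periods
`τ i` with `‖S φ₀ (τ i)‖ > δ`. Chosen to improve fast, they make `S φ₀` nearly additive, so the
vectors `S φ₀ (τ i)` have bounded subset sums, and the Bessaga–Pełczyński theorem yields a copy of
`c₀`. -/

namespace SumAP

open Filter Topology Asymptotics

/-! ### Difference calculus of the sum function -/

section Sum

variable {X : Type*} [NormedAddCommGroup X]

theorem sumFn_zero (φ : ℤ → X) : sumFn φ 0 = 0 := by simp [sumFn]

theorem sumFn_add_one (φ : ℤ → X) (t : ℤ) : sumFn φ (t + 1) = sumFn φ t + φ t := by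
  unfold sumFn
  rcases le_or_gt 0 t with h | h
  · have e : Finset.Ico 0 (t + 1) = insert t (Finset.Ico 0 t) := by
      ext k; simp only [Finset.mem_Ico, Finset.mem_insert]; omega
    rw [e, Finset.sum_insert (by simp), Finset.Ico_eq_empty_of_le h,
      Finset.Ico_eq_empty_of_le (show (0 : ℤ) ≤ t + 1 by omega)]
    simp [add_comm]
  · have e : Finset.Ico t 0 = insert t (Finset.Ico (t + 1) 0) := by
      ext k; simp only [Finset.mem_Ico, Finset.mem_insert]; omega
    rw [e, Finset.sum_insert (by simp), Finset.Ico_eq_empty_of_le h.le,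
      Finset.Ico_eq_empty_of_le (show t + 1 ≤ (0 : ℤ) by omega)]
    simp

/-- Uniqueness for the difference equation; the identities for shifts, differences and constants
below are all checked through it. -/
theorem eq_sumFn {φ h : ℤ → X} (h0 : h 0 = 0) (h1 : ∀ t, h (t + 1) = h t + φ t) (t : ℤ) :
    h t = sumFn φ t := by
  induction t with
  | zero => rw [h0, sumFn_zero]
  | succ n ih => rw [h1, sumFn_add_one, ih]
  | pred n ih =>
    have a := h1 (-n - 1)
    have b := sumFn_add_one φ (-n - 1)
    rw [sub_add_cancel] at a b
    rw [a, b] at ih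
    exact add_right_cancel ih

theorem sumFn_natCast (φ : ℤ → X) (n : ℕ) : sumFn φ n = ∑ k ∈ Finset.range n, φ k := by
  induction n with
  | zero => simp [sumFn_zero]
  | succ n ih => rw [Finset.sum_range_succ, ← ih, ← sumFn_add_one]; norm_cast

theorem sumFn_shift (φ : ℤ → X) (τ t : ℤ) :
    sumFn (fun k => φ (k + τ)) t = sumFn φ (t + τ) - sumFn φ τ := by
  refine (eq_sumFn (h := fun t => sumFn φ (t + τ) - sumFn φ τ) (by simp) (fun t => ?_) t).symm
  rw [add_right_comm, sumFn_add_one]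
  abel

theorem sumFn_sub (φ ψ : ℤ → X) (t : ℤ) :
    sumFn (fun k => φ k - ψ k) t = sumFn φ t - sumFn ψ t := by
  refine (eq_sumFn (h := fun t => sumFn φ t - sumFn ψ t) (by simp [sumFn_zero])
    (fun t => ?_) t).symm
  simp only [sumFn_add_one]
  abel

theorem norm_sumFn_le {φ : ℤ → X} {ε : ℝ} (h : ∀ k, ‖φ k‖ ≤ ε) (t : ℤ) :
    ‖sumFn φ t‖ ≤ |(t : ℝ)| * ε := by
  have key : ∀ s : Finset ℤ, ‖∑ k ∈ s, φ k‖ ≤ s.card * ε := fun s =>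
    (norm_sum_le_of_le s fun k _ => h k).trans_eq (by simp)
  unfold sumFn
  rcases le_or_gt 0 t with ht | ht
  · rw [Finset.Ico_eq_empty_of_le ht, Finset.sum_empty, sub_zero]
    refine (key _).trans_eq ?_
    lift t to ℕ using ht
    simp
  · rw [Finset.Ico_eq_empty_of_le ht.le, Finset.sum_empty, zero_sub, norm_neg]
    refine (key _).trans_eq ?_
    obtain ⟨n, rfl⟩ : ∃ n : ℕ, t = -n := ⟨t.natAbs, by omega⟩
    simp

theorem norm_sumFn_add_sub_le {φ : ℤ → X} {ε : ℝ} (h : ∀ k, ‖φ k‖ ≤ ε) (t s : ℤ) :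
    ‖sumFn φ (t + s) - sumFn φ s‖ ≤ |(t : ℝ)| * ε := by
  rw [← sumFn_shift]
  exact norm_sumFn_le (fun k => h _) t

/-- The sum function is additive up to a small error when one argument is an almost period. -/
theorem norm_sumFn_add_period_le {φ : ℤ → X} {ε : ℝ} {τ : ℤ} (h : ∀ t, ‖φ (t + τ) - φ t‖ ≤ ε)
    (t : ℤ) : ‖sumFn φ (t + τ) - sumFn φ τ - sumFn φ t‖ ≤ |(t : ℝ)| * ε := by
  rw [← sumFn_shift, ← sumFn_sub]
  exact norm_sumFn_le h t

end Sum

/-! ### Window averages and the mean -/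

section AP

variable {X : Type*} [NormedAddCommGroup X]

theorem RelativelyDense.exists_ge {E : Set ℤ} (h : RelativelyDense E) (L : ℤ) :
    ∃ e ∈ E, L ≤ e := by
  obtain ⟨F, hF⟩ := h
  obtain ⟨a, ha, e, he, h⟩ := hF (L + ∑ a ∈ F, |a|)
  refine ⟨e, he, ?_⟩
  have h1 := Finset.single_le_sum (f := fun a : ℤ => |a|) (fun i _ => abs_nonneg i) ha
  have h2 := le_abs_self a
  omega

theorem MemAP.exists_bound {φ : ℤ → X} (h : MemAP φ) : ∃ B, 0 ≤ B ∧ ∀ t, ‖φ t‖ ≤ B := by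
  obtain ⟨F, hF⟩ := h 1 one_pos
  refine ⟨1 + ∑ a ∈ F, ‖φ a‖, by positivity, fun t => ?_⟩
  obtain ⟨a, ha, e, he, rfl⟩ := hF t
  have h1 := Finset.single_le_sum (f := fun a : ℤ => ‖φ a‖) (fun i _ => norm_nonneg _) ha
  have h2 := he a
  have h3 := norm_le_norm_add_norm_sub' (φ (a + e)) (φ a)
  rw [add_comm e a]
  linarith

theorem MemAP.sub_const {φ : ℤ → X} (h : MemAP φ) (a : X) : MemAP fun t => φ t - a := by
  intro ε hε
  simpa using h ε hε

theorem memBUC_iff {φ : ℤ → X} : MemBUC φ ↔ ∃ C : ℝ, ∀ t, ‖φ t‖ ≤ C := by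
  simp [MemBUC, MemBUCWeight]

/-- Write the starting point as `s = e + a` with `e` an `ε/2`-period and `a` in a finite set. Moving
the window by `e` costs at most `n * (ε/2)`; moving it by `a` costs at most `2 * B * |a|`, which
does not grow with `n`. -/
theorem MemAP.exists_uniform_windows {φ : ℤ → X} (h : MemAP φ) {ε : ℝ} (hε : 0 < ε) :
    ∃ n₀ : ℕ, ∀ n : ℕ, n₀ ≤ n → ∀ s : ℤ,
      ‖sumFn φ (n + s) - sumFn φ s - sumFn φ n‖ ≤ ε * n := by
  obtain ⟨B, hB0, hB⟩ := h.exists_bound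
  obtain ⟨F, hF⟩ := h (ε / 2) (by positivity)
  obtain ⟨n₀, hn₀⟩ := exists_nat_ge ((∑ a ∈ F, |(a : ℝ)|) * (2 * B) / (ε / 2))
  refine ⟨n₀, fun n hn s => ?_⟩
  obtain ⟨a, ha, e, he, rfl⟩ := hF s
  have h1 : ‖sumFn φ (n + (e + a)) - sumFn φ (e + a) - (sumFn φ (n + a) - sumFn φ a)‖
      ≤ (n : ℝ) * (ε / 2) := by
    have := norm_sumFn_add_sub_le he n a
    rw [sumFn_sub, sumFn_sub, sumFn_shift, sumFn_shift] at this
    refine (le_of_eq ?_).trans (this.trans_eq (by simp))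
    congr 1
    rw [add_comm e a, add_assoc]
    abel
  have h2 := norm_sumFn_add_sub_le hB a n
  have h3 := norm_sumFn_le hB a
  have h4 := Finset.single_le_sum (f := fun a : ℤ => |(a : ℝ)|) (fun i _ => abs_nonneg _) ha
  have h5 : (∑ a ∈ F, |(a : ℝ)|) * (2 * B) ≤ n * (ε / 2) := by
    rw [← div_le_iff₀ (by positivity)]
    exact hn₀.trans (by exact_mod_cast hn)
  have h6 : |(a : ℝ)| * (2 * B) ≤ (∑ a ∈ F, |(a : ℝ)|) * (2 * B) :=
    mul_le_mul_of_nonneg_right h4 (by positivity)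
  have h7 : sumFn φ (n + (e + a)) - sumFn φ (e + a) - sumFn φ n
      = (sumFn φ (n + (e + a)) - sumFn φ (e + a) - (sumFn φ (n + a) - sumFn φ a))
        + (sumFn φ (a + n) - sumFn φ n) - sumFn φ a := by
    rw [add_comm a (n : ℤ)]; abel
  rw [h7]
  refine (norm_sub_le _ _).trans ?_
  have := norm_add_le (sumFn φ (n + (e + a)) - sumFn φ (e + a) - (sumFn φ (n + a) - sumFn φ a))
    (sumFn φ (a + n) - sumFn φ n)
  linarith

theorem norm_sumFn_mul_sub_le {φ : ℤ → X} {ε : ℝ} {n : ℕ}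
    (h : ∀ s : ℤ, ‖sumFn φ (n + s) - sumFn φ s - sumFn φ n‖ ≤ ε * n) (m : ℕ) :
    ‖sumFn φ (n * m : ℕ) - m • sumFn φ n‖ ≤ ε * n * m := by
  induction m with
  | zero => simp [sumFn_zero]
  | succ m ih =>
    have e : sumFn φ (n * (m + 1) : ℕ) - (m + 1) • sumFn φ n
        = (sumFn φ (n + (n * m : ℕ)) - sumFn φ (n * m : ℕ) - sumFn φ n)
          + (sumFn φ (n * m : ℕ) - m • sumFn φ n) := by
      rw [add_smul, one_smul, show ((n * (m + 1) : ℕ) : ℤ) = n + (n * m : ℕ) by push_cast; ring]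
      abel
    rw [e]
    refine (norm_add_le _ _).trans ((add_le_add (h _) ih).trans_eq ?_)
    push_cast; ring

variable [NormedSpace ℂ X]

theorem MemAP.exists_mean [CompleteSpace X] {φ : ℤ → X} (h : MemAP φ) :
    ∃ a : X, ∀ ε : ℝ, 0 < ε → ∃ n₀ : ℕ, ∀ n : ℕ, n₀ ≤ n → ∀ s : ℤ,
      ‖sumFn φ (n + s) - sumFn φ s - (n : ℂ) • a‖ ≤ ε * n := by
  obtain ⟨c, hcu⟩ : ∃ c : ℕ → X, ∀ n : ℕ, (n : ℂ) • c n = sumFn φ n := by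
    refine ⟨fun n => (n : ℂ)⁻¹ • sumFn φ n, fun n => ?_⟩
    rcases Nat.eq_zero_or_pos n with rfl | hn
    · simp [sumFn_zero]
    · rw [smul_inv_smul₀ (by exact_mod_cast hn.ne')]
  -- The averages of lengths `m` and `n` are both compared with the one of length `n * m`, cut into
  -- windows of either length.
  have hC : CauchySeq c := by
    rw [Metric.cauchySeq_iff]
    intro ε hε
    obtain ⟨n₀, hn₀⟩ := h.exists_uniform_windows (ε := ε / 3) (by positivity)
    refine ⟨n₀ + 1, fun m hm n hn => ?_⟩
    have h1 := norm_sumFn_mul_sub_le (hn₀ n (by omega)) m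
    have h2 := norm_sumFn_mul_sub_le (hn₀ m (by omega)) n
    rw [mul_comm m n] at h2
    have hnm : (0 : ℝ) < n * m := by
      have : 0 < n * m := Nat.mul_pos (by omega) (by omega)
      exact_mod_cast this
    have h3 : ‖((n * m : ℕ) : ℂ) • (c m - c n)‖ ≤ 2 * (ε / 3) * (n * m) := by
      have e : ((n * m : ℕ) : ℂ) • (c m - c n)
          = (sumFn φ (n * m : ℕ) - m • sumFn φ n) - (sumFn φ (n * m : ℕ) - n • sumFn φ m) := by
        rw [← hcu n, ← hcu m, ← Nat.cast_smul_eq_nsmul ℂ, ← Nat.cast_smul_eq_nsmul ℂ,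
          smul_smul, smul_smul, smul_sub, Nat.cast_mul, mul_comm (m : ℂ)]
        abel
      rw [e]
      refine (norm_sub_le _ _).trans ((add_le_add h1 h2).trans_eq ?_)
      ring
    rw [norm_smul, Complex.norm_natCast, Nat.cast_mul, mul_comm] at h3
    rw [dist_eq_norm]
    have := le_of_mul_le_mul_right h3 hnm
    linarith
  obtain ⟨a, ha⟩ := cauchySeq_tendsto_of_complete hC
  refine ⟨a, fun ε hε => ?_⟩
  obtain ⟨n₀, hn₀⟩ := h.exists_uniform_windows (ε := ε / 2) (by positivity)
  obtain ⟨n₁, hn₁⟩ := Metric.tendsto_atTop.1 ha (ε / 2) (by positivity)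
  refine ⟨max n₀ n₁, fun n hn s => ?_⟩
  have h1 := hn₀ n (le_of_max_le_left hn) s
  have h2 := hn₁ n (le_of_max_le_right hn)
  rw [dist_eq_norm] at h2
  have e : sumFn φ (n + s) - sumFn φ s - (n : ℂ) • a
      = (sumFn φ (n + s) - sumFn φ s - sumFn φ n) + (n : ℂ) • (c n - a) := by
    rw [smul_sub, hcu]; abel
  rw [e]
  refine (norm_add_le _ _).trans ?_
  rw [norm_smul, Complex.norm_natCast]
  have : (n : ℝ) * ‖c n - a‖ ≤ n * (ε / 2) := mul_le_mul_of_nonneg_left h2.le (by positivity)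
  linarith

theorem hasMaakMean_maakMean {φ : ℤ → X} {a : X} (h : HasMaakMean φ a) :
    HasMaakMean φ (maakMean φ) := by
  have h' : ∃ a, HasMaakMean φ a := ⟨a, h⟩
  rw [maakMean, dif_pos h']
  exact h'.choose_spec

theorem HasMaakMean.maakMean_eq {φ : ℤ → X} {a : X} (h : HasMaakMean φ a) : maakMean φ = a :=
  (hasMaakMean_maakMean h).unique h

theorem sumFn_const (a : X) (t : ℤ) : sumFn (fun _ => a) t = (t : ℂ) • a := by
  refine (eq_sumFn (h := fun t : ℤ => (t : ℂ) • a) (by simp) (fun t => ?_) t).symm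
  simp [add_smul]

/-- A Bohr almost periodic function has a Maak mean, and its partial sums grow linearly along
the mean. -/
theorem MemAP.hasMaakMean [CompleteSpace X] {φ : ℤ → X} (h : MemAP φ) :
    HasMaakMean φ (maakMean φ) ∧
      (fun n : ℕ => sumFn (fun t => φ t - maakMean φ) n) =o[atTop] fun n : ℕ => (n : ℝ) := by
  obtain ⟨a, ha⟩ := h.exists_mean
  have hm : HasMaakMean φ a := by
    obtain ⟨B, -, hB⟩ := h.exists_bound
    refine ⟨memBUC_iff.2 ⟨B, hB⟩, fun ε hε => ?_⟩
    obtain ⟨n₀, hn₀⟩ := ha (ε / 2) (by positivity)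
    have hpos : (0 : ℝ) < (n₀ + 1 : ℕ) := by positivity
    refine ⟨(Finset.range (n₀ + 1)).map Nat.castEmbedding, by simp, fun s => ?_⟩
    have h1 := hn₀ (n₀ + 1) (by omega) s
    rw [← sumFn_shift, sumFn_natCast] at h1
    simp only [Finset.card_map, Finset.card_range, Finset.sum_map, Nat.castEmbedding_apply,
      Finset.sum_sub_distrib, Finset.sum_const, ← Nat.cast_smul_eq_nsmul ℂ]
    rw [norm_smul, norm_inv, Complex.norm_natCast, inv_mul_lt_iff₀ hpos]
    simp only [add_comm s]
    refine h1.trans_lt ?_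
    nlinarith
  rw [hm.maakMean_eq]
  refine ⟨hm, isLittleO_iff.2 fun ε hε => ?_⟩
  obtain ⟨n₀, hn₀⟩ := ha ε hε
  filter_upwards [eventually_ge_atTop n₀] with n hn
  have := hn₀ n hn 0
  rw [sumFn_sub, sumFn_const]
  simpa [sumFn_zero] using this

end AP
end SumAP

namespace SumAP

open Filter Topology Asymptotics

/-! ### Growth of iterated sums and boundedness of the first sum -/

section IterSum

variable {X : Type*} [NormedAddCommGroup X]

theorem iterSum_succ (m : ℕ) (φ : ℤ → X) : iterSum (m + 1) φ = sumFn (iterSum m φ) :=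
  Function.iterate_succ_apply' _ _ _

theorem iterSum_one (φ : ℤ → X) : iterSum 1 φ = sumFn φ := rfl

theorem iterSum_succ_natCast_succ (m : ℕ) (φ : ℤ → X) (n : ℕ) :
    iterSum (m + 1) φ (n + 1 : ℕ) = iterSum (m + 1) φ n + iterSum m φ n := by
  rw [iterSum_succ, Nat.cast_succ, sumFn_add_one]

/-- Iterated sums of a function with `o(n)` sums. -/
theorem isLittleO_iterSum {φ : ℤ → X}
    (h : (fun n : ℕ => sumFn φ n) =o[atTop] fun n : ℕ => (n : ℝ)) (j : ℕ) :
    (fun n : ℕ => iterSum (j + 1) φ n) =o[atTop] fun n : ℕ => (n : ℝ) ^ (j + 1) := by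
  induction j with
  | zero => simpa [iterSum_one] using h
  | succ j ih =>
    -- The weight `(n + 1)^(j+1)` is at least `1` even at `n = 0`, so its partial sums diverge, as
    -- summing a little-o requires; they stay below `n^(j+2)`.
    have h1 : (fun n : ℕ => iterSum (j + 1) φ n) =o[atTop] fun n : ℕ => ((n : ℝ) + 1) ^ (j + 1) := by
      refine ih.trans_isBigO (IsBigO.of_bound 1 (Eventually.of_forall fun n => ?_))
      rw [one_mul, Real.norm_of_nonneg (by positivity), Real.norm_of_nonneg (by positivity)]
      gcongr
      linarith
    have h2 := h1.sum_range (fun n => by positivity) (by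
      refine tendsto_atTop_mono (fun n => ?_) tendsto_natCast_atTop_atTop
      calc (n : ℝ) = ∑ i ∈ Finset.range n, (1 : ℝ) := by simp
        _ ≤ _ := Finset.sum_le_sum fun i _ => one_le_pow₀ (by linarith [i.cast_nonneg (α := ℝ)]))
    simp only [iterSum_succ (j + 1), sumFn_natCast]
    refine h2.trans_isBigO (IsBigO.of_bound 1 (Eventually.of_forall fun n => ?_))
    rw [one_mul, Real.norm_of_nonneg (Finset.sum_nonneg fun _ _ => by positivity),
      Real.norm_of_nonneg (by positivity)]
    calc ∑ i ∈ Finset.range n, ((i : ℝ) + 1) ^ (j + 1)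
        ≤ ∑ i ∈ Finset.range n, (n : ℝ) ^ (j + 1) := Finset.sum_le_sum fun i hi => by
          gcongr
          exact_mod_cast Finset.mem_range.1 hi
      _ = (n : ℝ) ^ (j + 1 + 1) := by simp; ring

theorem descFactorial_sub_pow_isBigO (m : ℕ) :
    (fun n : ℕ => (n.descFactorial (m + 1) : ℂ) - (n : ℂ) ^ (m + 1)) =O[atTop]
      fun n : ℕ => (n : ℝ) ^ m := by
  induction m with
  | zero => simpa using isBigO_zero (E' := ℂ) (fun _ : ℕ => (1 : ℝ)) atTop
  | succ m ih =>
    have h1 : (fun n : ℕ => (n : ℂ)) =O[atTop] fun n : ℕ => (n : ℝ) :=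
      IsBigO.of_bound 1 (Eventually.of_forall fun n => by simp)
    have h2 : (fun n : ℕ => (n.descFactorial (m + 1) : ℂ)) =O[atTop]
        fun n : ℕ => (n : ℝ) ^ (m + 1) :=
      IsBigO.of_bound 1 (Eventually.of_forall fun n => by
        rw [one_mul, Complex.norm_natCast, Real.norm_of_nonneg (by positivity)]
        exact_mod_cast Nat.descFactorial_le_pow n (m + 1))
    have h3 := (h1.mul ih).sub (h2.const_mul_left ((m + 1 : ℕ) : ℂ) |>.congr_right fun n => by
      rw [pow_succ'])
    refine (h3.congr_left fun n => ?_).congr_right fun n => (pow_succ' _ _).symm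
    -- Where natural subtraction truncates, the falling factorial on the right vanishes, so the
    -- identity holds for all `n`.
    have e : (n.descFactorial (m + 1 + 1) : ℂ)
        = ((n : ℂ) - (m + 1 : ℕ)) * n.descFactorial (m + 1) := by
      rw [Nat.descFactorial_succ n (m + 1)]
      rcases le_or_gt (m + 1) n with h | h
      · rw [Nat.cast_mul, Nat.cast_sub h]
      · rw [Nat.descFactorial_of_lt h]; simp
    rw [e]
    ring

theorem choose_sub_isBigO (m : ℕ) :
    (fun n : ℕ => (n.choose (m + 1) : ℂ) - (n : ℂ) ^ (m + 1) / ((m + 1).factorial : ℕ))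
      =O[atTop] fun n : ℕ => (n : ℝ) ^ m := by
  refine ((descFactorial_sub_pow_isBigO m).const_mul_left
    ((((m + 1).factorial : ℕ) : ℂ)⁻¹)).congr_left fun n => ?_
  have : (((m + 1).factorial : ℕ) : ℂ) ≠ 0 := by exact_mod_cast (m + 1).factorial_ne_zero
  rw [Nat.descFactorial_eq_factorial_mul_choose]
  push_cast
  field_simp

theorem tendsto_add_sub_of_succ {f : ℕ → X} (h : Tendsto (fun n => f (n + 1) - f n) atTop (𝓝 0))
    (s : ℕ) : Tendsto (fun n => f (n + s) - f n) atTop (𝓝 0) := by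
  induction s with
  | zero => simp
  | succ s ih =>
    have h1 := (h.comp (tendsto_add_atTop_nat s)).add ih
    rw [add_zero] at h1
    refine h1.congr fun n => ?_
    simp [← add_assoc]

/-- `S φ (t)` is close to the increment of `S φ` from `τ` to `t + τ` for an almost period `τ`, which
may lie arbitrarily far to the right. The threshold for `n` may depend on the window length `s`;
only `K` must not. -/
theorem MemAP.memBUC_sumFn {φ : ℤ → X} (hφ : MemAP φ) {K : ℝ}
    (h : ∀ s : ℕ, ∀ᶠ n : ℕ in atTop, ‖sumFn φ (n + s : ℕ) - sumFn φ n‖ ≤ K) :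
    MemBUC (sumFn φ) := by
  refine memBUC_iff.2 ⟨K + 1, fun t => ?_⟩
  obtain ⟨n₀, hn₀⟩ := eventually_atTop.1 (h t.natAbs)
  -- The accuracy `1 / (|t| + 1)` keeps the error over `|t|` steps below `1`; the lower bound on `τ`
  -- puts both `τ` and `t + τ` past `n₀`.
  obtain ⟨τ, hτ, hL⟩ := (hφ (1 / (|(t : ℝ)| + 1)) (by positivity)).exists_ge (n₀ + t.natAbs)
  have h1 := norm_sumFn_add_period_le hτ t
  have h2 : |(t : ℝ)| * (1 / (|(t : ℝ)| + 1)) ≤ 1 := by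
    rw [mul_one_div, div_le_one (by positivity)]
    linarith
  have h3 : ‖sumFn φ (t + τ) - sumFn φ τ‖ ≤ K := by
    rcases le_or_gt 0 t with ht | ht
    · have h4 := hn₀ τ.natAbs (by omega)
      rwa [show ((τ.natAbs + t.natAbs : ℕ) : ℤ) = t + τ by omega,
        show ((τ.natAbs : ℕ) : ℤ) = τ by omega] at h4
    · have h4 := hn₀ (t + τ).natAbs (by omega)
      rwa [show (((t + τ).natAbs + t.natAbs : ℕ) : ℤ) = τ by omega,
        show (((t + τ).natAbs : ℕ) : ℤ) = t + τ by omega, norm_sub_rev] at h4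
  have h5 := norm_sub_norm_le (sumFn φ t) (sumFn φ (t + τ) - sumFn φ τ)
  rw [norm_sub_rev (sumFn φ t)] at h5
  linarith

theorem MemBUCWeight.isBigO {f : ℤ → X} {N : ℕ} (h : MemBUCWeight (polyWeight N) f) :
    (fun n : ℕ => f n) =O[atTop] fun n : ℕ => (n : ℝ) ^ N := by
  obtain ⟨C, hC⟩ := h
  refine IsBigO.of_bound (C * 2 ^ N) ?_
  filter_upwards [eventually_ge_atTop 1] with n hn
  have h1 : (1 : ℝ) ≤ n := by exact_mod_cast hn
  have h2 := hC n
  have hp : 0 < polyWeight N n := by unfold polyWeight; positivity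
  have hC0 : 0 ≤ C := le_trans (div_nonneg (norm_nonneg _) hp.le) h2
  rw [div_le_iff₀ hp] at h2
  refine h2.trans ?_
  rw [Real.norm_of_nonneg (by positivity), mul_assoc, ← mul_pow]
  unfold polyWeight
  rw [Int.cast_natCast, Nat.abs_cast]
  gcongr
  linarith

variable [NormedSpace ℂ X]

/-- Pascal's rule: the iterated sums of the constant `1` are binomial coefficients. -/
theorem iterSum_natCast_eq_add (φ : ℤ → X) (a : X) (m n : ℕ) :
    iterSum m φ n = iterSum m (fun t => φ t - a) n + (n.choose m : ℂ) • a := by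
  induction m generalizing n with
  | zero => simp [iterSum]
  | succ m ih =>
    induction n with
    | zero => simp [iterSum_succ, sumFn_zero]
    | succ n ihn =>
      rw [iterSum_succ_natCast_succ, iterSum_succ_natCast_succ, ihn, ih,
        Nat.choose_succ_succ, Nat.cast_add, add_smul]
      abel

theorem natCast_pow_smul_isBigO {f : ℕ → X} {g : ℕ → ℝ} (b : ℂ) (k : ℕ) (h : f =O[atTop] g) :
    (fun n : ℕ => (b * (n : ℂ) ^ k) • f n) =O[atTop] fun n : ℕ => (n : ℝ) ^ k * g n := by
  have : (fun n : ℕ => b * (n : ℂ) ^ k) =O[atTop] fun n : ℕ => (n : ℝ) ^ k :=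
    IsBigO.of_bound ‖b‖ (Eventually.of_forall fun n => by simp)
  exact this.smul h

theorem natCast_pow_smul_isLittleO {f : ℕ → X} {g : ℕ → ℝ} (b : ℂ) (k : ℕ)
    (h : f =o[atTop] g) :
    (fun n : ℕ => (b * (n : ℂ) ^ k) • f n) =o[atTop] fun n : ℕ => (n : ℝ) ^ k * g n := by
  have : (fun n : ℕ => b * (n : ℂ) ^ k) =O[atTop] fun n : ℕ => (n : ℝ) ^ k :=
    IsBigO.of_bound ‖b‖ (Eventually.of_forall fun n => by simp)
  exact this.smul_isLittleO h

/-- The contribution of the constant `a` to the weighted combination of iterated sums is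
`n ^ (N + 1)` times a fixed multiple of `a`, up to lower order terms. -/
theorem sum_choose_smul_sub_isBigO (N : ℕ) (b : ℕ → ℂ) (a : X) :
    (fun n : ℕ => ∑ j ∈ Finset.range (N + 1),
        (b j * (n : ℂ) ^ (N - j)) • (n.choose (j + 1) : ℂ) • a
      - (n : ℂ) ^ (N + 1) • (∑ j ∈ Finset.range (N + 1), b j / ((j + 1).factorial : ℕ)) • a)
      =O[atTop] fun n : ℕ => (n : ℝ) ^ N := by
  have h : ∀ j ∈ Finset.range (N + 1), (fun n : ℕ => (b j * (n : ℂ) ^ (N - j)) •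
      ((n.choose (j + 1) : ℂ) - (n : ℂ) ^ (j + 1) / ((j + 1).factorial : ℕ)) • a)
      =O[atTop] fun n : ℕ => (n : ℝ) ^ N := fun j hj => by
    have hj' : j ≤ N := Nat.lt_succ_iff.1 (Finset.mem_range.1 hj)
    have h1 : (fun n : ℕ =>
        ((n.choose (j + 1) : ℂ) - (n : ℂ) ^ (j + 1) / ((j + 1).factorial : ℕ)) • a)
        =O[atTop] fun n : ℕ => (n : ℝ) ^ j :=
      ((choose_sub_isBigO j).smul (isBigO_const_const a (one_ne_zero (α := ℝ)) atTop)).congr_right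
        fun n => by simp
    refine (natCast_pow_smul_isBigO (b j) (N - j) h1).congr_right fun n => ?_
    rw [← pow_add, Nat.sub_add_cancel hj']
  refine (IsBigO.fun_sum h).congr_left fun n => ?_
  rw [smul_smul, Finset.mul_sum, Finset.sum_smul, ← Finset.sum_sub_distrib]
  refine Finset.sum_congr rfl fun j hj => ?_
  have hj' : j ≤ N := Nat.lt_succ_iff.1 (Finset.mem_range.1 hj)
  rw [sub_smul, smul_sub, smul_smul (b j * _) (_ / _) a]
  congr 2
  rw [show N + 1 = N - j + (j + 1) by omega, pow_add]
  ring

theorem eq_zero_of_natCast_pow_smul_isLittleO {a : X} {k : ℕ}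
    (h : (fun n : ℕ => (n : ℂ) ^ k • a) =o[atTop] fun n : ℕ => (n : ℝ) ^ k) : a = 0 := by
  by_contra ha
  have hpos : 0 < ‖a‖ := norm_pos_iff.2 ha
  obtain ⟨n, hn, h1⟩ := ((isLittleO_iff.1 h (half_pos hpos)).and (eventually_ge_atTop 1)).exists
  have h2 : (0 : ℝ) < (n : ℝ) ^ k := by
    have : (0 : ℝ) < n := by exact_mod_cast h1
    positivity
  rw [norm_smul, norm_pow, norm_pow, Complex.norm_natCast, Real.norm_natCast, mul_comm] at hn
  have := le_of_mul_le_mul_right hn h2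
  linarith

theorem abs_inv_succ_pow_sub_le (j : ℕ) {n : ℕ} (hn : 1 ≤ n) :
    |((n : ℝ) + 1)⁻¹ ^ j - (n : ℝ)⁻¹ ^ j| ≤ j * (n : ℝ)⁻¹ ^ (j + 1) := by
  have h0 : (0 : ℝ) < n := by exact_mod_cast hn
  have h1 : ((n : ℝ) + 1)⁻¹ ≤ (n : ℝ)⁻¹ := inv_anti₀ h0 (by linarith)
  rcases j with _ | j
  · simp
  refine (abs_pow_sub_pow_le _ _ _).trans ?_
  rw [abs_of_nonneg (a := ((n : ℝ) + 1)⁻¹) (by positivity),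
    abs_of_nonneg (a := (n : ℝ)⁻¹) (by positivity), max_eq_right h1, abs_of_nonpos (by linarith)]
  have h2 : -(((n : ℝ) + 1)⁻¹ - (n : ℝ)⁻¹) ≤ (n : ℝ)⁻¹ ^ 2 := by
    have : -(((n : ℝ) + 1)⁻¹ - (n : ℝ)⁻¹) = (n : ℝ)⁻¹ * ((n : ℝ) + 1)⁻¹ := by
      field_simp; ring
    rw [this, sq]
    gcongr
  calc -(((n : ℝ) + 1)⁻¹ - (n : ℝ)⁻¹) * ((j + 1 : ℕ) : ℝ) * (n : ℝ)⁻¹ ^ (j + 1 - 1)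
      ≤ (n : ℝ)⁻¹ ^ 2 * ((j + 1 : ℕ) : ℝ) * (n : ℝ)⁻¹ ^ (j + 1 - 1) := by gcongr
    _ = _ := by rw [Nat.add_sub_cancel]; ring

/-- The normalised iterated sums of order at least two vary slowly. -/
theorem tendsto_normalised_iterSum_sub {φ : ℤ → X}
    (h : (fun n : ℕ => sumFn φ n) =o[atTop] fun n : ℕ => (n : ℝ)) (j : ℕ) :
    Tendsto (fun n : ℕ => ((n + 1 : ℕ) : ℂ)⁻¹ ^ (j + 1) • iterSum (j + 2) φ (n + 1 : ℕ)
      - (n : ℂ)⁻¹ ^ (j + 1) • iterSum (j + 2) φ n) atTop (𝓝 0) := by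
  -- Discrete product rule: the increment is `(n+1)^(-(j+1)) S^(j+1) φ (n)` plus the increment of
  -- `n^(-(j+1))`, which is `O(n^(-(j+2)))`, times `S^(j+2) φ (n)`. Both terms are `o(1)`.
  have h1 := isLittleO_iterSum h j
  have h2 := isLittleO_iterSum h (j + 1)
  have c1 : (fun n : ℕ => ((n + 1 : ℕ) : ℂ)⁻¹ ^ (j + 1)) =O[atTop]
      fun n : ℕ => (n : ℝ)⁻¹ ^ (j + 1) := by
    refine IsBigO.of_bound 1 ?_
    filter_upwards [eventually_ge_atTop 1] with n hn
    have h0 : (0 : ℝ) < n := by exact_mod_cast hn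
    rw [one_mul, norm_pow, norm_inv, Complex.norm_natCast, Real.norm_of_nonneg (by positivity)]
    push_cast
    gcongr
    linarith
  have c2 : (fun n : ℕ => ((n + 1 : ℕ) : ℂ)⁻¹ ^ (j + 1) - (n : ℂ)⁻¹ ^ (j + 1)) =O[atTop]
      fun n : ℕ => (n : ℝ)⁻¹ ^ (j + 2) := by
    refine IsBigO.of_bound (j + 1 : ℕ) ?_
    filter_upwards [eventually_ge_atTop 1] with n hn
    have h0 : (0 : ℝ) < n := by exact_mod_cast hn
    have e : ((n + 1 : ℕ) : ℂ)⁻¹ ^ (j + 1) - (n : ℂ)⁻¹ ^ (j + 1)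
        = ((((n : ℝ) + 1)⁻¹ ^ (j + 1) - (n : ℝ)⁻¹ ^ (j + 1) : ℝ) : ℂ) := by push_cast; rfl
    rw [e, Complex.norm_real, Real.norm_eq_abs, Real.norm_of_nonneg (by positivity)]
    exact abs_inv_succ_pow_sub_le (j + 1) hn
  have e : ∀ k : ℕ, (fun n : ℕ => (n : ℝ)⁻¹ ^ k • (n : ℝ) ^ k) =ᶠ[atTop] fun _ => (1 : ℝ) := by
    intro k
    filter_upwards [eventually_ge_atTop 1] with n hn
    have h0 : (n : ℝ) ≠ 0 := by exact_mod_cast (by omega : n ≠ 0)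
    rw [smul_eq_mul, ← mul_pow, inv_mul_cancel₀ h0, one_pow]
  have t1 := (isLittleO_one_iff ℝ).1 ((c1.smul_isLittleO h1).congr' .rfl (e _))
  have t2 := (isLittleO_one_iff ℝ).1 ((c2.smul_isLittleO h2).congr' .rfl (e _))
  refine ((t1.add t2).congr fun n => ?_).trans (by rw [add_zero])
  rw [iterSum_succ_natCast_succ (j + 1), smul_add, sub_smul]
  abel

/-- If a weighted combination of iterated sums, with non-zero leading coefficient, is
`O(n ^ N)`, then the increments of the first sum over windows far out are bounded uniformly in
the length of the window. -/
theorem exists_eventually_norm_sumFn_add_sub_le {φ : ℤ → X} {N : ℕ} {b : ℕ → ℂ} (hb : b 0 ≠ 0)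
    (h : (fun n : ℕ => sumFn φ n) =o[atTop] fun n : ℕ => (n : ℝ))
    (hO : (fun n : ℕ => ∑ j ∈ Finset.range (N + 1),
      (b j * (n : ℂ) ^ (N - j)) • iterSum (j + 1) φ n) =O[atTop] fun n : ℕ => (n : ℝ) ^ N) :
    ∃ K : ℝ, ∀ s : ℕ, ∀ᶠ n : ℕ in atTop, ‖sumFn φ (n + s : ℕ) - sumFn φ n‖ ≤ K := by
  -- For `n ≥ 1` this is `n^(-N)` times the terms of order at least two, reindexed by `j + 1`.
  set H : ℕ → X := fun n => ∑ j ∈ Finset.range N,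
    b (j + 1) • (n : ℂ)⁻¹ ^ (j + 1) • iterSum (j + 2) φ n with hH
  have hstep : Tendsto (fun n => H (n + 1) - H n) atTop (𝓝 0) := by
    have := tendsto_finsetSum (Finset.range N) fun j _ =>
      (tendsto_normalised_iterSum_sub h j).const_smul (b (j + 1))
    simp only [smul_zero, Finset.sum_const_zero] at this
    refine this.congr fun n => ?_
    rw [hH]
    simp only [smul_sub, Finset.sum_sub_distrib]
  obtain ⟨C, hC⟩ := hO.bound
  have hC' : ∀ᶠ n : ℕ in atTop, ‖b 0 • sumFn φ n + H n‖ ≤ C := by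
    filter_upwards [hC, eventually_ge_atTop 1] with n hn h1
    have h0 : (0 : ℝ) < n := by exact_mod_cast h1
    have h0' : (n : ℂ) ≠ 0 := by exact_mod_cast h0.ne'
    have e : b 0 • sumFn φ n + H n = (n : ℂ)⁻¹ ^ N • ∑ j ∈ Finset.range (N + 1),
        (b j * (n : ℂ) ^ (N - j)) • iterSum (j + 1) φ n := by
      rw [Finset.sum_range_succ', smul_add, Finset.smul_sum, add_comm]
      congr 1
      · refine Finset.sum_congr rfl fun j hj => ?_
        have hj' : j + 1 ≤ N := Finset.mem_range.1 hj
        rw [smul_smul, smul_smul]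
        congr 1
        rw [inv_pow, inv_pow]
        field_simp
        rw [mul_assoc, ← pow_add,
          Nat.add_sub_cancel' hj']
      · rw [smul_smul, iterSum_one, Nat.sub_zero]
        congr 1
        rw [inv_pow]
        field_simp
    rw [e, norm_smul, norm_pow, norm_inv, Complex.norm_natCast]
    rw [Real.norm_of_nonneg (by positivity)] at hn
    calc (n : ℝ)⁻¹ ^ N * _ ≤ (n : ℝ)⁻¹ ^ N * (C * (n : ℝ) ^ N) := by gcongr
      _ = C := by rw [inv_pow]; field_simp
  -- `2 * C` bounds the difference of two values of `b 0 • sumFn φ + H`; `1` bounds the increment of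
  -- `H` over `s` steps, once `n` is large depending on `s`.
  refine ⟨(2 * C + 1) / ‖b 0‖, fun s => ?_⟩
  have hs := (tendsto_add_sub_of_succ hstep s).norm.eventually_le_const
    (show ‖(0 : X)‖ < 1 by simp)
  filter_upwards [hC', (tendsto_add_atTop_nat s).eventually hC', hs] with n h1 h2 h3
  rw [le_div_iff₀ (norm_pos_iff.2 hb), mul_comm, ← norm_smul]
  have e : b 0 • (sumFn φ (n + s : ℕ) - sumFn φ n)
      = (b 0 • sumFn φ (n + s : ℕ) + H (n + s)) - (b 0 • sumFn φ n + H n)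
        - (H (n + s) - H n) := by
    rw [smul_sub]; abel
  rw [e]
  have h4 := norm_sub_le (b 0 • sumFn φ (n + s : ℕ) + H (n + s)) (b 0 • sumFn φ n + H n)
  refine (norm_sub_le _ _).trans ?_
  linarith

end IterSum
end SumAP

namespace SumAP

open Filter Topology Asymptotics

/-! ### Rosenthal's lemma on infinite matrices -/

section Rosenthal

open scoped ENNReal

/-- **Rosenthal's lemma**: a non-negative infinite matrix with bounded row sums has an infinite
principal submatrix whose off-diagonal row sums are small. -/
theorem exists_offDiag_tsum_le (ε : ℝ≥0∞) (hε : ε ≠ ∞) (k : ℕ) (m : ℕ → ℕ → ℝ≥0∞)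
    (hm : ∀ i, ∑' j, m i j ≤ k * ε) :
    ∃ e : ℕ → ℕ, Function.Injective e ∧
      ∀ i, ∑' j, (if j = i then 0 else m (e i) (e j)) ≤ ε := by
  induction k generalizing m with
  | zero =>
    refine ⟨id, Function.injective_id, fun i => ?_⟩
    refine le_trans (ENNReal.tsum_le_tsum fun j => ?_) ((hm i).trans (by simp))
    split_ifs <;> simp
  | succ k ih =>
    -- `Nat.pair` splits `ℕ` into infinitely many infinite blocks. If no block works, each block `p`
    -- has an index `f p` whose matrix row has off-diagonal mass above `ε` inside the block. The
    -- indices `Nat.pair p (f p)` meet block `p` only on the diagonal, so the submatrix on them has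
    -- row sums smaller by `ε`, and induction applies.
    by_cases H : ∃ p, ∀ i, ∑' j, (if j = i then 0 else m (Nat.pair p i) (Nat.pair p j)) ≤ ε
    · obtain ⟨p, hp⟩ := H
      exact ⟨Nat.pair p, fun a b hab => (Nat.pair_eq_pair.1 hab).2, hp⟩
    push Not at H
    choose f hf using H
    have hg : Function.Injective fun p => Nat.pair p (f p) :=
      fun a b hab => (Nat.pair_eq_pair.1 hab).1
    obtain ⟨e, he, h⟩ := ih (fun p q => m (Nat.pair p (f p)) (Nat.pair q (f q))) fun p => by
      set r := m (Nat.pair p (f p)) with hr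
      have h1 : ∑' q, r (Nat.pair q (f q))
          + ∑' j, (if j = f p then 0 else r (Nat.pair p j)) ≤ ∑' j, r j := by
        have e1 : ∑' q, r (Nat.pair q (f q))
            = ∑' j, Set.indicator (Set.range fun q => Nat.pair q (f q)) r j := by
          rw [← tsum_subtype, tsum_range r hg]
        have e2 : ∑' j, (if j = f p then 0 else r (Nat.pair p j))
            = ∑' j, Set.indicator (Set.range fun j : {j // j ≠ f p} => Nat.pair p j) r j := by
          rw [← tsum_subtype, tsum_range r
            (fun a b hab => Subtype.ext (Nat.pair_eq_pair.1 hab).2)]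
          refine Eq.trans (tsum_congr fun j => ?_)
            (tsum_subtype {j | j ≠ f p} fun j => r (Nat.pair p j)).symm
          by_cases hj : j = f p <;> simp [Set.indicator, hj]
        rw [e1, e2, ← ENNReal.tsum_add]
        refine ENNReal.tsum_le_tsum fun j => ?_
        by_cases hj : j ∈ Set.range fun q => Nat.pair q (f q)
        · have : j ∉ Set.range fun j : {j // j ≠ f p} => Nat.pair p j := by
            rintro ⟨⟨i, hi⟩, rfl⟩
            obtain ⟨q, hq⟩ := hj
            have := Nat.pair_eq_pair.1 hq
            obtain ⟨rfl, h2⟩ := this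
            exact hi h2.symm
          simp [Set.indicator_of_mem hj, Set.indicator_of_notMem this]
        · rw [Set.indicator_of_notMem hj, zero_add]
          exact Set.indicator_le_self' (fun _ _ => zero_le) _
      have h2 := (add_le_add_right (hf p).le _).trans (h1.trans (hm _))
      rw [Nat.cast_succ, add_mul, one_mul] at h2
      exact ENNReal.le_of_add_le_add_right hε h2
    exact ⟨fun p => Nat.pair (e p) (f (e p)), fun a b hab => he (hg hab), h⟩

end Rosenthal

/-! ### Bounded subset sums and copies of `c₀` -/

section BessagaPelczynski

variable {X : Type*} [NormedAddCommGroup X] [NormedSpace ℂ X]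

theorem sum_abs_le_of_subset_sums {ι : Type*} {x : ι → ℝ} {K : ℝ}
    (h : ∀ A : Finset ι, |∑ i ∈ A, x i| ≤ K) (A : Finset ι) : ∑ i ∈ A, |x i| ≤ 2 * K := by
  classical
  rw [← Finset.sum_filter_add_sum_filter_not A (fun i => 0 ≤ x i)]
  have h1 : ∑ i ∈ A with 0 ≤ x i, |x i| ≤ K := by
    rw [Finset.sum_congr rfl fun i hi => abs_of_nonneg (Finset.mem_filter.1 hi).2]
    exact (le_abs_self _).trans (h _)
  have h2 : ∑ i ∈ A with ¬ 0 ≤ x i, |x i| ≤ K := by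
    rw [Finset.sum_congr rfl fun i hi => abs_of_neg (not_le.1 (Finset.mem_filter.1 hi).2),
      Finset.sum_neg_distrib]
    exact (neg_le_abs _).trans (h _)
  linarith

/-- The series is weakly unconditionally Cauchy; the factor `4` comes from two signs for each of the
real and imaginary parts. -/
theorem sum_norm_dual_le {ι : Type*} {x : ι → X} {K : ℝ}
    (h : ∀ A : Finset ι, ‖∑ i ∈ A, x i‖ ≤ K) {f : StrongDual ℂ X} (hf : ‖f‖ ≤ 1)
    (A : Finset ι) : ∑ i ∈ A, ‖f (x i)‖ ≤ 4 * K := by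
  have h0 : ∀ A : Finset ι, ‖∑ i ∈ A, f (x i)‖ ≤ K := fun A => by
    rw [← map_sum]
    refine (f.le_opNorm _).trans ?_
    have := mul_le_mul_of_nonneg_right hf (norm_nonneg (∑ i ∈ A, x i))
    linarith [h A]
  have h1 := sum_abs_le_of_subset_sums (x := fun i => (f (x i)).re) (fun A => by
    rw [← Complex.re_sum]
    exact (Complex.abs_re_le_norm _).trans (h0 A)) A
  have h2 := sum_abs_le_of_subset_sums (x := fun i => (f (x i)).im) (fun A => by
    rw [← Complex.im_sum]
    exact (Complex.abs_im_le_norm _).trans (h0 A)) A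
  have h3 : ∑ i ∈ A, ‖f (x i)‖ ≤ ∑ i ∈ A, (|(f (x i)).re| + |(f (x i)).im|) :=
    Finset.sum_le_sum fun i _ => Complex.norm_le_abs_re_add_abs_im _
  rw [Finset.sum_add_distrib] at h3
  linarith

theorem norm_sum_smul_le {ι : Type*} {x : ι → X} {K : ℝ}
    (h : ∀ A : Finset ι, ‖∑ i ∈ A, x i‖ ≤ K) {a : ι → ℂ} {c : ℝ} (hc : 0 ≤ c) {A : Finset ι}
    (ha : ∀ i ∈ A, ‖a i‖ ≤ c) : ‖∑ i ∈ A, a i • x i‖ ≤ c * (4 * K) := by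
  obtain ⟨f, hf, hfx⟩ := exists_dual_vector'' ℂ (∑ i ∈ A, a i • x i)
  have e : ‖∑ i ∈ A, a i • x i‖ = ‖f (∑ i ∈ A, a i • x i)‖ := by rw [hfx]; simp
  rw [e, map_sum]
  refine (norm_sum_le _ _).trans ?_
  refine le_trans ?_ (mul_le_mul_of_nonneg_left (sum_norm_dual_le h hf A) hc)
  rw [Finset.mul_sum]
  refine Finset.sum_le_sum fun i hi => ?_
  rw [map_smul, norm_smul]
  exact mul_le_mul_of_nonneg_right (ha i hi) (norm_nonneg _)

theorem summable_smul_of_subset_sums [CompleteSpace X] {x : ℕ → X} {K : ℝ}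
    (h : ∀ A : Finset ℕ, ‖∑ i ∈ A, x i‖ ≤ K) (a : C₀(ℕ, ℂ)) : Summable fun i => a i • x i := by
  have hK : 0 ≤ K := by simpa using h ∅
  rw [summable_iff_vanishing_norm]
  intro ε hε
  have h0 : Tendsto a cofinite (𝓝 0) := by
    have := a.zero_at_infty'
    rwa [Filter.cocompact_eq_cofinite] at this
  set c := ε / (4 * K + 1)
  have hc : 0 < c := by positivity
  have h1 : {i | ¬ ‖a i‖ < c}.Finite := by
    have := (tendsto_zero_iff_norm_tendsto_zero.1 h0).eventually (gt_mem_nhds hc)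
    exact this
  refine ⟨h1.toFinset, fun t ht => ?_⟩
  refine (norm_sum_smul_le h hc.le fun i hi => ?_).trans_lt ?_
  · by_contra hi'
    exact Finset.disjoint_left.1 ht hi (h1.mem_toFinset.2 fun h => hi' h.le)
  · have : c * (4 * K + 1) = ε := div_mul_cancel₀ _ (by positivity)
    linarith

/-- The **Bessaga–Pełczyński theorem**: a series in a Banach space with bounded subset sums
whose terms do not become small produces a copy of `c₀`. -/
theorem containsC0_of_subset_sums [CompleteSpace X] {x : ℕ → X} {K δ : ℝ} (hδ : 0 < δ)
    (hx : ∀ n, δ ≤ ‖x n‖) (h : ∀ A : Finset ℕ, ‖∑ i ∈ A, x i‖ ≤ K) : ContainsC0 X := by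
  choose f hf hfx using fun n => exists_dual_vector'' ℂ (x n)
  -- The matrix `‖f i (x j)‖` has row sums at most `4 * K ≤ k * (δ / 2)` and diagonal at least `δ`;
  -- Rosenthal's lemma thins it to off-diagonal row sums at most `δ / 2`.
  obtain ⟨k, hk⟩ := exists_nat_ge (4 * K / (δ / 2))
  rw [div_le_iff₀ (by positivity)] at hk
  obtain ⟨e, he, hoff⟩ := exists_offDiag_tsum_le (ENNReal.ofReal (δ / 2)) ENNReal.ofReal_ne_top k
    (fun i j => ENNReal.ofReal ‖f i (x j)‖) fun i => by
      rw [ENNReal.tsum_eq_iSup_sum]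
      refine iSup_le fun A => ?_
      rw [← ENNReal.ofReal_sum_of_nonneg fun _ _ => norm_nonneg _, ← ENNReal.ofReal_natCast,
        ← ENNReal.ofReal_mul (by positivity)]
      exact ENNReal.ofReal_le_ofReal ((sum_norm_dual_le h (hf i) A).trans hk)
  have h' : ∀ A : Finset ℕ, ‖∑ i ∈ A, x (e i)‖ ≤ K := fun A => by
    have := h (A.map ⟨e, he⟩)
    rwa [Finset.sum_map] at this
  have hS := fun a => summable_smul_of_subset_sums h' a
  let T₀ : C₀(ℕ, ℂ) →ₗ[ℂ] X :=
    { toFun := fun a => ∑' i, a i • x (e i)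
      map_add' := fun a b => by
        rw [← (hS a).tsum_add (hS b)]
        simp [add_smul]
      map_smul' := fun c a => by
        rw [RingHom.id_apply, ← (hS a).tsum_const_smul]
        simp [smul_smul] }
  have hnorm : ∀ (a : C₀(ℕ, ℂ)) (i : ℕ), ‖a i‖ ≤ ‖a‖ := fun a i => by
    rw [← ZeroAtInftyContinuousMap.norm_toBCF_eq_norm]
    exact a.toBCF.norm_coe_le_norm i
  have hnorm' : ∀ (a : C₀(ℕ, ℂ)) (C : ℝ), (∀ i, ‖a i‖ ≤ C) → ‖a‖ ≤ C := fun a C hC => by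
    rw [← ZeroAtInftyContinuousMap.norm_toBCF_eq_norm]
    exact (BoundedContinuousFunction.norm_le ((norm_nonneg _).trans (hC 0))).2 hC
  have hT : ∀ a, ‖T₀ a‖ ≤ 4 * K * ‖a‖ := fun a => by
    refine le_of_tendsto (hS a).hasSum.norm (Eventually.of_forall fun A => ?_)
    rw [mul_comm]
    exact norm_sum_smul_le h' (norm_nonneg a) fun i _ => hnorm a i
  refine ⟨T₀.mkContinuous _ hT, δ / 2, by positivity, fun a => ?_⟩
  change δ / 2 * ‖a‖ ≤ ‖T₀ a‖
  -- The functional `f (e n)` sees the `n`-th term with weight at least `δ` and the other terms with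
  -- total at most `δ / 2 * ‖a‖`. The supremum over `n` then gives the lower bound `δ / 2`.
  have key : ∀ n, ‖a n‖ ≤ (‖T₀ a‖ + δ / 2 * ‖a‖) / δ := fun n => by
    rw [le_div_iff₀ hδ]
    have h1 : HasSum (fun i => f (e n) (a i • x (e i))) (f (e n) (T₀ a)) :=
      (hS a).hasSum.mapL (f (e n))
    have hg : ∀ A : Finset ℕ, ∑ i ∈ A, (if i = n then 0 else ‖f (e n) (x (e i))‖) ≤ δ / 2 := by
      intro A
      have := (ENNReal.sum_le_tsum A).trans (hoff n)
      have e1 : ∀ i, (if i = n then 0 else ENNReal.ofReal ‖f (e n) (x (e i))‖)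
          = ENNReal.ofReal (if i = n then 0 else ‖f (e n) (x (e i))‖) := fun i => by
        split_ifs <;> simp
      simp only [e1] at this
      rw [← ENNReal.ofReal_sum_of_nonneg fun i _ => by split_ifs <;> positivity] at this
      exact (ENNReal.ofReal_le_ofReal_iff (by positivity)).1 this
    have h2 : ‖f (e n) (T₀ a) - f (e n) (a n • x (e n))‖ ≤ δ / 2 * ‖a‖ := by
      have ht : Tendsto (fun A : Finset ℕ =>
          ‖∑ i ∈ A, f (e n) (a i • x (e i)) - f (e n) (a n • x (e n))‖) atTop
          (𝓝 ‖f (e n) (T₀ a) - f (e n) (a n • x (e n))‖) :=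
        (Tendsto.sub_const h1 _).norm
      refine le_of_tendsto ht ?_
      filter_upwards [eventually_ge_atTop {n}] with A hA
      rw [← Finset.sum_erase_eq_sub (by simpa using hA)]
      refine (norm_sum_le _ _).trans ?_
      refine le_trans ?_ (mul_le_mul_of_nonneg_right (hg (A.erase n)) (norm_nonneg a))
      rw [Finset.sum_mul]
      refine Finset.sum_le_sum fun i hi => ?_
      rw [if_neg (Finset.ne_of_mem_erase hi), map_smul, norm_smul, mul_comm]
      exact mul_le_mul_of_nonneg_left (hnorm a i) (norm_nonneg _)
    have h3 : ‖f (e n) (T₀ a)‖ ≤ ‖T₀ a‖ := by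
      refine ((f (e n)).le_opNorm _).trans ?_
      have := mul_le_mul_of_nonneg_right (hf (e n)) (norm_nonneg (T₀ a))
      linarith
    have h4 : ‖a n‖ * δ ≤ ‖f (e n) (a n • x (e n))‖ := by
      rw [map_smul, norm_smul, hfx]
      refine mul_le_mul_of_nonneg_left ((hx (e n)).trans_eq ?_) (norm_nonneg _)
      simp
    have h5 := norm_sub_norm_le (f (e n) (a n • x (e n))) (f (e n) (T₀ a))
    rw [norm_sub_rev] at h5
    linarith
  have := hnorm' a _ key
  rw [le_div_iff₀ hδ] at this
  linarith

end BessagaPelczynski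

/-! ### Kadets' theorem for sums -/

section Kadets

variable {X : Type*} [NormedAddCommGroup X]

/-- If the sum function is small at all sufficiently good almost periods of an almost periodic
function, then it is almost periodic. -/
theorem MemAP.sumFn_of_small {φ : ℤ → X} (hφ : MemAP φ)
    (h : ∀ δ : ℝ, 0 < δ → ∃ ε : ℝ, 0 < ε ∧
      ∀ τ, (∀ t, ‖φ (t + τ) - φ t‖ ≤ ε) → ‖sumFn φ τ‖ ≤ δ) : MemAP (sumFn φ) := by
  intro δ hδ
  obtain ⟨ε, hε, hs⟩ := h (δ / 3) (by positivity)
  obtain ⟨F, hF⟩ := hφ (ε / 2) (by positivity)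
  set R := ∑ a ∈ F, |(a : ℝ)| with hR
  have hR0 : 0 ≤ R := Finset.sum_nonneg fun _ _ => abs_nonneg _
  -- Such `τ` are `δ`-periods of the sum. Any point is `σ + r` with `σ` an `ε/2`-period and `r ∈ F`;
  -- then `σ` and `σ + τ` are `ε`-periods, where the sum is at most `δ/3`, and the remaining `|r| ≤
  -- R` steps cost at most another `δ/3`.
  obtain ⟨G, hG⟩ := hφ (min (ε / 2) (δ / 3 / (R + 1))) (by positivity)
  refine ⟨G, fun t => ?_⟩
  obtain ⟨a, ha, τ, hτ, ht⟩ := hG t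
  refine ⟨a, ha, τ, fun t => ?_, ht⟩
  obtain ⟨r, hr, σ, hσ, rfl⟩ := hF t
  have h1 : ‖sumFn φ σ‖ ≤ δ / 3 := hs σ fun t => (hσ t).trans (by linarith)
  have h2 : ‖sumFn φ (σ + τ)‖ ≤ δ / 3 := hs _ fun t => by
    have h3 := norm_add_le (φ (t + σ + τ) - φ (t + σ)) (φ (t + σ) - φ t)
    rw [sub_add_sub_cancel, add_assoc] at h3
    have h4 := (hτ (t + σ)).trans (min_le_left _ _)
    rw [add_assoc] at h4
    linarith [hσ t]
  have h3 : ‖sumFn φ (r + (σ + τ)) - sumFn φ (σ + τ) - (sumFn φ (r + σ) - sumFn φ σ)‖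
      ≤ δ / 3 := by
    rw [← sumFn_shift, ← sumFn_shift, ← sumFn_sub]
    refine (norm_sumFn_le (ε := δ / 3 / (R + 1)) (fun k => ?_) r).trans ?_
    · rw [← add_assoc]
      exact (hτ _).trans (min_le_right _ _)
    · have h4 := Finset.single_le_sum (f := fun a : ℤ => |(a : ℝ)|) (fun i _ => abs_nonneg _) hr
      rw [mul_div_assoc', div_le_iff₀ (by positivity), mul_comm]
      exact mul_le_mul_of_nonneg_left (h4.trans (by linarith)) (by positivity)
  have e : sumFn φ (σ + r + τ) - sumFn φ (σ + r)
      = (sumFn φ (r + (σ + τ)) - sumFn φ (σ + τ) - (sumFn φ (r + σ) - sumFn φ σ))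
        + sumFn φ (σ + τ) - sumFn φ σ := by
    rw [show σ + r + τ = r + (σ + τ) by ring, add_comm σ r]; abel
  rw [e]
  refine (norm_sub_le _ _).trans ?_
  refine (add_le_add_left (norm_add_le _ _) _).trans ?_
  linarith

/-- Along rapidly improving almost periods the sum function is nearly additive. -/
theorem norm_sumFn_sum_sub_le {φ : ℤ → X} {τ : ℕ → ℤ}
    (h : ∀ n t, ‖φ (t + τ n) - φ t‖ ≤ (1 / 2) ^ n / (1 + ∑ i ∈ Finset.range n, |(τ i : ℝ)|))
    (n : ℕ) (A : Finset ℕ) (hA : A ⊆ Finset.range n) :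
    ‖sumFn φ (∑ i ∈ A, τ i) - ∑ i ∈ A, sumFn φ (τ i)‖ ≤ ∑ i ∈ Finset.range n, (1 / 2 : ℝ) ^ i := by
  induction n generalizing A with
  | zero =>
    obtain rfl : A = ∅ := by simpa using hA
    simp [sumFn_zero]
  | succ n ih =>
    rw [Finset.sum_range_succ]
    have hsub : A.erase n ⊆ Finset.range n := fun i hi => by
      have h1 := Finset.mem_range.1 (hA (Finset.mem_of_mem_erase hi))
      have h2 := Finset.ne_of_mem_erase hi
      exact Finset.mem_range.2 (by omega)
    have h1 := ih (A.erase n) hsub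
    by_cases hn : n ∈ A
    -- The largest index is split off: `τ n` is so accurate that its error over the distance `|s|`,
    -- at most the sum of the earlier `|τ i|`, is below `(1/2)^n`.
    · rw [← Finset.sum_erase_add A _ hn, ← Finset.sum_erase_add A _ hn]
      set s := ∑ i ∈ A.erase n, τ i with hs
      have h2 := norm_sumFn_add_period_le (h n) s
      have h3 : |(s : ℝ)| ≤ 1 + ∑ i ∈ Finset.range n, |(τ i : ℝ)| := by
        rw [hs, Int.cast_sum]
        have h4 := Finset.abs_sum_le_sum_abs (fun i => (τ i : ℝ)) (A.erase n)
        have h5 := Finset.sum_le_sum_of_subset_of_nonneg hsub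
          (f := fun i => |(τ i : ℝ)|) fun _ _ _ => abs_nonneg _
        linarith
      have h4 : |(s : ℝ)| * ((1 / 2) ^ n / (1 + ∑ i ∈ Finset.range n, |(τ i : ℝ)|))
          ≤ (1 / 2) ^ n := by
        have hp : 0 < 1 + ∑ i ∈ Finset.range n, |(τ i : ℝ)| :=
          add_pos_of_pos_of_nonneg one_pos (Finset.sum_nonneg fun _ _ => abs_nonneg _)
        rw [mul_div_assoc', div_le_iff₀ hp, mul_comm]
        exact mul_le_mul_of_nonneg_left h3 (by positivity)
      have e : sumFn φ (s + τ n) - (∑ i ∈ A.erase n, sumFn φ (τ i) + sumFn φ (τ n))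
          = (sumFn φ s - ∑ i ∈ A.erase n, sumFn φ (τ i))
            + (sumFn φ (s + τ n) - sumFn φ (τ n) - sumFn φ s) := by abel
      rw [e]
      exact (norm_add_le _ _).trans (add_le_add h1 (h2.trans h4))
    · rw [Finset.erase_eq_of_notMem hn] at h1
      have : (0 : ℝ) ≤ (1 / 2) ^ n := by positivity
      linarith

/-- **Kadets' theorem** for sums: in a Banach space without a copy of `c₀`, bounded sums of
almost periodic functions are almost periodic. -/
theorem MemAP.sumFn_of_not_containsC0 [NormedSpace ℂ X] [CompleteSpace X] {φ : ℤ → X}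
    (hφ : MemAP φ) (hb : MemBUC (sumFn φ)) (hX : ¬ ContainsC0 X) : MemAP (sumFn φ) := by
  by_contra hcon
  refine hX ?_
  obtain ⟨K, hK⟩ := memBUC_iff.1 hb
  have h : ∃ δ : ℝ, 0 < δ ∧ ∀ ε : ℝ, 0 < ε →
      ∃ τ, (∀ t, ‖φ (t + τ) - φ t‖ ≤ ε) ∧ δ < ‖sumFn φ τ‖ := by
    by_contra! H
    exact hcon (hφ.sumFn_of_small H)
  obtain ⟨δ, hδ, h⟩ := h
  have hpos : ∀ (n : ℕ) (R : ℝ), 0 ≤ R → 0 < (1 / 2 : ℝ) ^ n / (1 + R) := fun n R hR => by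
    positivity
  choose! g hg hgδ using h
  -- `st n` is the sum of the absolute values of the first `n` almost periods chosen
  let st : ℕ → ℝ := fun n => Nat.rec 0
    (fun n R => R + |(g ((1 / 2 : ℝ) ^ n / (1 + R)) : ℝ)|) n
  let τ : ℕ → ℤ := fun n => g ((1 / 2 : ℝ) ^ n / (1 + st n))
  have hst : ∀ n, st n = ∑ i ∈ Finset.range n, |(τ i : ℝ)| := fun n => by
    induction n with
    | zero => rfl
    | succ n ih => rw [Finset.sum_range_succ, ← ih]
  have hst0 : ∀ n, 0 ≤ st n := fun n => by
    rw [hst]; exact Finset.sum_nonneg fun _ _ => abs_nonneg _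
  -- In `K + 2`, `K` bounds the sum function at `∑ τ i` and `2` the geometric series of additivity
  -- errors.
  refine containsC0_of_subset_sums (x := fun n => sumFn φ (τ n)) (K := K + 2) hδ
    (fun n => (hgδ _ (hpos n _ (hst0 n))).le) fun A => ?_
  have h1 := norm_sumFn_sum_sub_le (φ := φ) (τ := τ)
    (fun n t => by rw [← hst]; exact hg _ (hpos n _ (hst0 n)) t) _ A A.subset_range_sup_succ
  have h2 := sum_geometric_two_le (A.sup id).succ
  have h3 := norm_sub_norm_le (∑ i ∈ A, sumFn φ (τ i)) (sumFn φ (∑ i ∈ A, τ i))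
  rw [norm_sub_rev] at h3
  linarith [hK (∑ i ∈ A, τ i)]

end Kadets
end SumAP

/-! ### Proof of the theorem -/

open scoped Asymptotics
theorem theorem7p7 {X : Type*} [NormedAddCommGroup X] [NormedSpace ℂ X] [CompleteSpace X]
    (N : ℕ) (b : ℕ → ℂ) (hb : b 0 ≠ 0) (φ : ℤ → X) (hφ : SumAP.MemAP φ)
    (hψ : SumAP.MemBUCWeight (SumAP.polyWeight N) (fun t : ℤ =>
      ∑ j ∈ Finset.range (N + 1), (b j * (t : ℂ) ^ (N - j)) • SumAP.iterSum (j + 1) φ t)) :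
    SumAP.HasMaakMean φ (SumAP.maakMean φ) ∧
    SumAP.MemBUC (SumAP.sumFn (fun t => φ t - SumAP.maakMean φ)) ∧
    (∑ j ∈ Finset.range (N + 1), b j / ((Nat.factorial (j + 1) : ℕ) : ℂ) ≠ 0 →
      SumAP.maakMean φ = 0 ∧ SumAP.MemBUC (SumAP.sumFn φ)) ∧
    (¬ SumAP.ContainsC0 X →
      SumAP.MemAP (SumAP.sumFn (fun t => φ t - SumAP.maakMean φ))) := by
  obtain ⟨hm, hlin⟩ := hφ.hasMaakMean
  set a := SumAP.maakMean φ
  set φ₀ : ℤ → X := fun t => φ t - a with hφ₀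
  have hφ₀AP : SumAP.MemAP φ₀ := hφ.sub_const a
  set c := ∑ j ∈ Finset.range (N + 1), b j / ((Nat.factorial (j + 1) : ℕ) : ℂ) with hc
  have hO := hψ.isBigO
  have hconst := SumAP.sum_choose_smul_sub_isBigO N b a
  set P : ℕ → X := fun n => ∑ j ∈ Finset.range (N + 1),
    (b j * (n : ℂ) ^ (N - j)) • SumAP.iterSum (j + 1) φ₀ n with hP
  have hlead : (fun n : ℕ => P n + (n : ℂ) ^ (N + 1) • c • a) =O[Filter.atTop]
      fun n : ℕ => (n : ℝ) ^ N := by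
    refine (hO.sub hconst).congr_left fun n => ?_
    rw [hP]
    simp only [SumAP.iterSum_natCast_eq_add φ a, smul_add, Finset.sum_add_distrib,
      Int.cast_natCast]
    abel
  have hPo : P =o[Filter.atTop] fun n : ℕ => (n : ℝ) ^ (N + 1) := by
    refine Asymptotics.IsLittleO.fun_sum fun j hj => ?_
    have hj' : j ≤ N := Nat.lt_succ_iff.1 (Finset.mem_range.1 hj)
    refine (SumAP.natCast_pow_smul_isLittleO (b j) (N - j)
      (SumAP.isLittleO_iterSum hlin j)).congr_right fun n => ?_
    rw [← pow_add]
    congr 1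
    omega
  have hpow : (fun n : ℕ => (n : ℝ) ^ N) =o[Filter.atTop] fun n : ℕ => (n : ℝ) ^ (N + 1) :=
    (Asymptotics.isLittleO_pow_pow_atTop_of_lt (𝕜 := ℝ) (Nat.lt_succ_self N)).comp_tendsto
      tendsto_natCast_atTop_atTop
  -- Both `P` and its sum with `n^(N+1) • c • a` are `o(n^(N+1))`. This suffices for the boundedness
  -- of the sum of `φ₀` even when `c = 0`.
  have hca : c • a = 0 := by
    refine SumAP.eq_zero_of_natCast_pow_smul_isLittleO (k := N + 1) ?_
    refine ((hlead.trans_isLittleO hpow).sub hPo).congr_left fun n => ?_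
    abel
  have hPO : P =O[Filter.atTop] fun n : ℕ => (n : ℝ) ^ N := by
    simpa [hca] using hlead
  obtain ⟨K, hK⟩ := SumAP.exists_eventually_norm_sumFn_add_sub_le hb hlin hPO
  have hbdd : SumAP.MemBUC (SumAP.sumFn φ₀) := hφ₀AP.memBUC_sumFn hK
  refine ⟨hm, hbdd, fun hc0 => ?_, hφ₀AP.sumFn_of_not_containsC0 hbdd⟩
  have ha : a = 0 := (smul_eq_zero.1 hca).resolve_left hc0
  refine ⟨ha, ?_⟩
  have : φ₀ = φ := by
    rw [hφ₀, ha]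
    simp
  rwa [this] at hbdd
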